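/- **Theorem 3.2.** Let $X$ be a real Hilbert space and let $T\colon X\rightrightarrows X$ be a set-valued mapping whose graph $\operatorname{gph}T=\{(u,v)\in X\times X : v\in T(u)\}$ is nonempty and closed in the norm topology of $X\times X$. The following assertions are equivalent: (i) $T$ is maximal monotone, i.e. $\langle v_1-v_2,u_1-u_2\rangle\ge 0$ for all $(u_1,v_1),(u_2,v_2)\in\operatorname{gph}T$, and $\operatorname{gph}T=\operatorname{gph}S$ for every set-valued mapping $S\colon X\rightrightarrows X$ having this monotonicity property and satisfying $\operatorname{gph}T\subset\operatorname{gph}S$. (ii) (a) $T$ is globally hypomonotone, i.e. there is $r>0$ such that $T+rI$ is monotone, where $(T+rI)(u)=\{v+ru : v\in T(u)\}$; and (b) $\langle z,w\rangle\ge 0$ for all $(u,v)\in\operatorname{gph}T$, $w\in X$ and $z\in\widehat D^*T(u,v)(w)$. Here $\widehat D^*T(u,v)(w)=\{z\in X : (z,-w)\in\widehat N((u,v);\operatorname{gph}T)\}$ is the regular (Fréchet) coderivative, where $X\times X$ carries its product Hilbert structure. For a subset $\Omega$ of a Hilbert space $E$ and $a\in\Omega$, the regular (Fréchet) normal cone is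 $$\widehat N(a;\Omega)=\Big\{x^*\in E : \liminf_{x\to a,\ x\ne a}\frac{\delta(x;\Omega)-\delta(a;\Omega)-\langle x^*,x-a\rangle}{\|x-a\|}\ge 0\Big\},$$ with $\delta(x;\Omega)=0$ for $x\in\Omega$ and $\delta(x;\Omega)=\infty$ for $x\notin\Omega$. -/

import Mathlib

namespace VarAnalysis

open Filter Topology

/-- The graph of a set-valued mapping `F : X ⇉ Y`. -/
def gph {X Y : Type*} (F : X → Set Y) : Set (X × Y) := {p | p.2 ∈ F p.1}

/-- The domain of a set-valued mapping. -/
def dom {X Y : Type*} (F : X → Set Y) : Set X := {u | (F u).Nonempty}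

/-- A set-valued mapping is proper if its domain is nonempty. -/
def IsProper {X Y : Type*} (F : X → Set Y) : Prop := (dom F).Nonempty

section Subdifferential

variable {E : Type*} [NormedAddCommGroup E] [InnerProductSpace ℝ E]

/-- The regular (Fréchet) subdifferential of an extended-real-valued function `f` at `a`:
the vectors `v` with `liminf_{u → a, u ≠ a} (f u - f a - ⟨v, u - a⟩) / ‖u - a‖ ≥ 0`.
It is empty when `f a = ∞`. -/
noncomputable def regularSubdifferential (f : E → EReal) (a : E) : Set E :=
  {v | f a < ⊤ ∧
    0 ≤ liminf (fun u : E => (f u - f a - ((inner ℝ v (u - a) : ℝ) : EReal)) /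
      ((‖u - a‖ : ℝ) : EReal)) (𝓝[≠] a)}

open Classical in
/-- The indicator function of `Ω`: it is `0` on `Ω` and `∞` outside `Ω`. -/
noncomputable def indicatorFun (Ω : Set E) (u : E) : EReal := if u ∈ Ω then 0 else ⊤

/-- The regular (Fréchet) normal cone to `Ω` at `a` (empty when `a ∉ Ω`). -/
noncomputable def regularNormalCone (a : E) (Ω : Set E) : Set E :=
  regularSubdifferential (indicatorFun Ω) a

end Subdifferential

section Operators

variable {X : Type*} [NormedAddCommGroup X] [InnerProductSpace ℝ X]

/-- The regular (Fréchet) coderivative of `F` at `(u, v)`: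
`z ∈ D̂*F(u, v)(w)` iff `(z, -w)` is a regular normal to the graph of `F` at `(u, v)`.
The product space carries its Hilbert structure
`⟨(a, b), (c, d)⟩ = ⟨a, c⟩ + ⟨b, d⟩`, that is, it is `WithLp 2 (X × X)`. -/
noncomputable def regularCoderivative (F : X → Set X) (u v w : X) : Set X :=
  {z | WithLp.toLp 2 (z, -w) ∈
    regularNormalCone (WithLp.toLp 2 (u, v)) {p : WithLp 2 (X × X) | WithLp.ofLp p ∈ gph F}}

/-- Monotonicity of a set-valued mapping. -/
def IsMonotone (T : X → Set X) : Prop :=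
  ∀ u₁ v₁ u₂ v₂ : X, (u₁, v₁) ∈ gph T → (u₂, v₂) ∈ gph T → 0 ≤ inner ℝ (v₁ - v₂) (u₁ - u₂)

/-- Maximal monotonicity: no monotone mapping has a strictly larger graph. -/
def IsMaximalMonotone (T : X → Set X) : Prop :=
  IsMonotone T ∧ ∀ S : X → Set X, IsMonotone S → gph T ⊆ gph S → gph T = gph S

/-- The mapping `T + r I`, that is, `u ↦ {v + r u | v ∈ T u}`. -/
def addSMulId (T : X → Set X) (r : ℝ) : X → Set X := fun u => (fun v => v + r • u) '' T u

/-- (Global) hypomonotonicity: `T + r I` is monotone for some `r > 0`. -/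
def IsHypomonotone (T : X → Set X) : Prop := ∃ r : ℝ, 0 < r ∧ IsMonotone (addSMulId T r)

end Operators

end VarAnalysis

namespace VarAnalysis

open Filter Topology

/-! The Cayley transform `u + l • v ↦ u - l • v` of `T` is nonexpansive exactly when `T` is
monotone.

For maximal `T`, Minty's theorem solves `a + b = u + v + t • (z - w)` in the graph for every `t`.
Testing a regular normal on these points as `t` tends to `0` gives `‖z - w‖ ≤ ‖z + w‖`, i.e. `0 ≤
⟨z, w⟩`.

Conversely, hypomonotonicity with constant `r` makes `I + l T` expansive for `l = 1 / (2 r)`, so its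
range is closed and its inverse is single-valued and Lipschitz. The coderivative condition bounds
proximal normals to the graph of the Cayley transform (`norm_le_of_proximal_cayley`). Approximate
projection onto the range then shows that the range is all of `X`, and a proximal mean value
inequality makes the Cayley transform nonexpansive. Monotonicity and surjectivity of `I + l T` give
maximality. A smooth variational principle supplies the approximate minimizers in both steps. -/

theorem mem_regularNormalCone_iff {E : Type*} [NormedAddCommGroup E] [InnerProductSpace ℝ E]
    {Ω : Set E} {a v : E} (ha : a ∈ Ω) :
    v ∈ regularNormalCone a Ω ↔
      ∀ ε > 0, ∀ᶠ x in 𝓝[Ω] a, inner ℝ v (x - a) ≤ ε * ‖x - a‖ := by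
  have key : ∀ (x : E) (ε : ℝ), x ≠ a →
      (((-ε : ℝ) : EReal) < (indicatorFun Ω x - indicatorFun Ω a -
        ((inner ℝ v (x - a) : ℝ) : EReal)) / ((‖x - a‖ : ℝ) : EReal) ↔
        (x ∈ Ω → inner ℝ v (x - a) < ε * ‖x - a‖)) := by
    intro x ε hx
    have hpos : 0 < ‖x - a‖ := norm_pos_iff.2 (sub_ne_zero.2 hx)
    by_cases h : x ∈ Ω
    · simp only [indicatorFun, h, ha, if_true, forall_const, sub_zero, zero_sub]
      rw [← EReal.coe_neg, ← EReal.coe_div, EReal.coe_lt_coe_iff, lt_div_iff₀ hpos]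
      constructor <;> intro h <;> linarith
    · simp only [indicatorFun, h, ha, if_true, if_false, sub_zero, EReal.top_sub_coe,
        IsEmpty.forall_iff, iff_true]
      rw [EReal.top_div_of_pos_ne_top (by exact_mod_cast hpos) (EReal.coe_ne_top _)]
      exact EReal.coe_lt_top _
  constructor
  · rintro ⟨-, hv⟩ ε hε
    rw [Filter.le_liminf_iff] at hv
    have := hv ((-ε : ℝ) : EReal) (by exact_mod_cast (by linarith : -ε < 0))
    rw [eventually_nhdsWithin_iff] at this ⊢
    filter_upwards [this] with x hx hxΩ
    rcases eq_or_ne x a with rfl | hne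
    · simp
    · exact ((key x ε hne).1 (hx hne) hxΩ).le
  · intro H
    refine ⟨by simp [indicatorFun, ha], ?_⟩
    rw [Filter.le_liminf_iff]
    intro y hy
    obtain ⟨c, hyc, hc⟩ := EReal.lt_iff_exists_real_btwn.1 hy
    have hc' : c < 0 := by exact_mod_cast hc
    have := H (-c / 2) (by linarith)
    rw [eventually_nhdsWithin_iff] at this ⊢
    filter_upwards [this] with x hx hne
    refine hyc.trans ?_
    have hpos : 0 < ‖x - a‖ := norm_pos_iff.2 (sub_ne_zero.2 hne)
    have := (key x (-c) hne).2 fun h => (hx h).trans_lt (by nlinarith)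
    rwa [neg_neg] at this

/-! ### Variational principles -/

theorem exists_approx_minimizer {E : Type*} {S : Set E} {G : E → ℝ} (hG : BddBelow (G '' S))
    {x : E} (hx : x ∈ S) {η : ℝ} (hη : 0 < η) :
    ∃ y ∈ S, G y ≤ G x ∧ ∀ z ∈ S, G y ≤ G z + η := by
  by_cases h : ∀ z ∈ S, G x ≤ G z + η
  · exact ⟨x, hx, le_rfl, h⟩
  · push Not at h
    obtain ⟨z, hz, hzx⟩ := h
    obtain ⟨-, ⟨y, hy, rfl⟩, hlt⟩ := Real.lt_sInf_add_pos (s := G '' S) ⟨_, z, hz, rfl⟩ hη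
    by_cases hxy : G y ≤ G x
    · exact ⟨y, hy, hxy, fun w hw => by linarith [csInf_le hG ⟨w, hw, rfl⟩]⟩
    · have := csInf_le hG ⟨z, hz, rfl⟩
      linarith

/-- A Borwein-Preiss type smooth variational principle in Hilbert spaces. -/
theorem exists_perturbed_minimizer {E : Type*} [NormedAddCommGroup E] [InnerProductSpace ℝ E]
    [CompleteSpace E] {S : Set E} (hS : IsClosed S) (hne : S.Nonempty) {f : E → ℝ}
    (hf : Continuous f) (hb : BddBelow (f '' S)) {ε : ℝ} (hε : 0 < ε) :
    ∃ a ∈ S, ∃ p : E, ‖p‖ ≤ 2 * ε ∧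
      ∀ x ∈ S, f a ≤ f x + inner ℝ p (x - a) + ε * ‖x - a‖ ^ 2 := by
  set μ : ℕ → ℝ := fun n => 1 / 2 / 2 ^ n with hμ
  have μpos : ∀ n, 0 < μ n := fun n => by positivity
  have μsum : HasSum μ 1 := hasSum_geometric_two' 1
  -- The tolerance is cubic in `μ n` so that the penalty `ε * μ n * ‖x (n + 1) - x n‖ ^ 2 ≤ η n`
  -- forces steps of length at most `μ n`.
  set η : ℕ → ℝ := fun n => ε * μ n * μ n ^ 2 with hη
  have ηpos : ∀ n, 0 < η n := fun n => by have := μpos n; positivity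
  have ηlim : Tendsto η atTop (𝓝 0) := by
    have := μsum.summable.tendsto_atTop_zero
    simpa using (this.const_mul ε).mul (this.pow 2)
  have hex : ∀ (G : E → ℝ) (δ : ℝ) (x : E), ∃ y, BddBelow (G '' S) → 0 < δ → x ∈ S →
      y ∈ S ∧ G y ≤ G x ∧ ∀ z ∈ S, G y ≤ G z + δ := by
    intro G δ x
    by_cases h : BddBelow (G '' S) ∧ 0 < δ ∧ x ∈ S
    · obtain ⟨y, hy⟩ := exists_approx_minimizer h.1 h.2.2 h.2.1
      exact ⟨y, fun _ _ _ => hy⟩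
    · exact ⟨x, fun h1 h2 h3 => absurd ⟨h1, h2, h3⟩ h⟩
  choose next hnext using hex
  obtain ⟨x₀, hx₀⟩ := hne
  let st : ℕ → (E → ℝ) × E := fun n => Nat.rec (f, next f (η 0) x₀)
    (fun n s => (fun x => s.1 x + ε * (μ n * ‖x - s.2‖ ^ 2),
      next (fun x => s.1 x + ε * (μ n * ‖x - s.2‖ ^ 2)) (η (n + 1)) s.2)) n
  set F : ℕ → E → ℝ := fun n => (st n).1 with hF
  set x : ℕ → E := fun n => (st n).2 with hx
  have F0 : F 0 = f := rfl
  have x0 : x 0 = next f (η 0) x₀ := rfl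
  have Fs : ∀ n, F (n + 1) = fun y => F n y + ε * (μ n * ‖y - x n‖ ^ 2) := fun n => rfl
  have xs : ∀ n, x (n + 1) = next (F (n + 1)) (η (n + 1)) (x n) := fun n => rfl
  clear_value F x
  have hmono : ∀ y, Monotone fun n => F n y := fun y => monotone_nat_of_le_succ fun n => by
    have := μpos n
    simp only [Fs]
    exact le_add_of_nonneg_right (by positivity)
  have hbdd : ∀ n, BddBelow (F n '' S) := by
    obtain ⟨b, hb⟩ := hb
    intro n
    refine ⟨b, ?_⟩
    rintro - ⟨y, hy, rfl⟩
    have h1 := hmono y (Nat.zero_le n)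
    simp only [F0] at h1
    exact (hb ⟨y, hy, rfl⟩).trans h1
  have xS : ∀ n, x n ∈ S := by
    intro n
    induction n with
    | zero => rw [x0]; exact (hnext _ _ _ hb (ηpos 0) hx₀).1
    | succ n ih => rw [xs]; exact (hnext _ _ _ (hbdd _) (ηpos _) ih).1
  have xmin : ∀ n, ∀ z ∈ S, F n (x n) ≤ F n z + η n := by
    intro n
    cases n with
    | zero => rw [x0, F0]; exact (hnext _ _ _ hb (ηpos 0) hx₀).2.2
    | succ n => rw [xs]; exact (hnext _ _ _ (hbdd _) (ηpos _) (xS n)).2.2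
  have xdec : ∀ n, F (n + 1) (x (n + 1)) ≤ F (n + 1) (x n) := by
    intro n
    rw [xs]
    exact (hnext _ _ _ (hbdd _) (ηpos _) (xS n)).2.1
  have hdist : ∀ n, dist (x n) (x (n + 1)) ≤ 1 / 2 / 2 ^ n := by
    intro n
    have h1 := xdec n
    have h2 := xmin n _ (xS (n + 1))
    simp only [Fs, sub_self, norm_zero] at h1
    have h3 : (ε * μ n) * ‖x (n + 1) - x n‖ ^ 2 ≤ (ε * μ n) * μ n ^ 2 := by
      simp only [hη] at h2
      nlinarith
    have h4 := le_of_mul_le_mul_left h3 (mul_pos hε (μpos n))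
    rw [dist_comm, dist_eq_norm]
    exact le_of_sq_le_sq h4 (μpos n).le
  obtain ⟨a, ha⟩ := cauchySeq_tendsto_of_complete (cauchySeq_of_le_geometric_two hdist)
  have hnorm : ∀ n, ‖a - x n‖ ≤ 1 := by
    intro n
    have := dist_le_of_le_geometric_two_of_tendsto hdist ha n
    rw [dist_comm, dist_eq_norm] at this
    exact this.trans (div_le_one_of_le₀ (one_le_pow₀ one_le_two) (by positivity))
  have aS : a ∈ S := hS.mem_of_tendsto ha (Eventually.of_forall xS)
  have hbound : ∀ n, ‖μ n • (a - x n)‖ ≤ μ n := fun n => by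
    rw [norm_smul, Real.norm_of_nonneg (μpos n).le]
    exact mul_le_of_le_one_right (μpos n).le (hnorm n)
  -- Expanding each penalty around `a`, this weighted sum collects the linear terms; the quadratic
  -- terms have total weight `1`.
  obtain ⟨p, hp⟩ := Summable.of_norm_bounded μsum.summable hbound
  have hp1 : ‖p‖ ≤ 1 := hp.norm_le_of_bounded μsum hbound
  have hsq : Summable fun n => μ n * ‖a - x n‖ ^ 2 :=
    Summable.of_nonneg_of_le (fun n => by have := μpos n; positivity)
      (fun n => mul_le_of_le_one_right (μpos n).le (pow_le_one₀ (norm_nonneg _) (hnorm n)))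
      μsum.summable
  obtain ⟨s, hs⟩ := hsq
  have hFsum : ∀ n y, F n y = f y + ε * ∑ k ∈ Finset.range n, μ k * ‖y - x k‖ ^ 2 := by
    intro n y
    induction n with
    | zero => simp [F0]
    | succ n ih => simp only [Fs, Finset.sum_range_succ, ih]; ring
  have hlim : ∀ y, Tendsto (fun n => F n y) atTop
      (𝓝 (f y + ε * (s + 2 * inner ℝ p (y - a) + ‖y - a‖ ^ 2))) := by
    intro y
    have h1 : HasSum (fun n => inner ℝ (μ n • (a - x n)) (y - a)) (inner ℝ p (y - a)) := by
      have := hp.mapL (innerSL ℝ (y - a))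
      simpa only [innerSL_apply_apply, real_inner_comm] using this
    have h2 := (hs.add (h1.mul_left 2)).add (μsum.mul_right (‖y - a‖ ^ 2))
    rw [one_mul] at h2
    have h3 := (h2.tendsto_sum_nat.const_mul ε).const_add (f y)
    refine h3.congr fun n => ?_
    rw [hFsum]
    congr 2
    refine Finset.sum_congr rfl fun k _ => ?_
    have : y - x k = (a - x k) + (y - a) := by abel
    rw [this, norm_add_sq_real, real_inner_smul_left]
    ring
  have hcont : ∀ n, Continuous (F n) := by
    intro n
    have : F n = fun y => f y + ε * ∑ k ∈ Finset.range n, μ k * ‖y - x k‖ ^ 2 :=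
      funext (hFsum n)
    rw [this]
    fun_prop
  refine ⟨a, aS, (2 * ε) • p, ?_, fun y hy => ?_⟩
  · rw [norm_smul, Real.norm_of_nonneg (by positivity)]
    exact mul_le_of_le_one_right (by positivity) hp1
  have h1 : ∀ m, F m a ≤ f y + ε * (s + 2 * inner ℝ p (y - a) + ‖y - a‖ ^ 2) := by
    intro m
    have h2 := (hlim y).add ηlim
    rw [add_zero] at h2
    refine le_of_tendsto_of_tendsto (((hcont m).tendsto a).comp ha) h2 ?_
    filter_upwards [eventually_ge_atTop m] with n hn
    exact (hmono _ hn).trans (xmin n y hy)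
  have h2 := le_of_tendsto' (hlim a) h1
  simp only [sub_self, inner_zero_right, norm_zero] at h2
  rw [real_inner_smul_left]
  linarith

/-- A strongly convex function given through its closed convex epigraph `C` attains its
minimum; the last line is the first-order optimality condition. -/
theorem exists_minimizer_of_convex {E : Type*} [NormedAddCommGroup E] [InnerProductSpace ℝ E]
    [CompleteSpace E] {C : Set (E × ℝ)} (hC : IsClosed C) (hconv : Convex ℝ C)
    (hne : C.Nonempty) (hb : ∀ c ∈ C, 0 ≤ c.2 + ‖c.1‖ ^ 2 / 2) :
    ∃ c ∈ C, ∀ d ∈ C, c.2 ≤ d.2 + inner ℝ c.1 (d.1 - c.1) := by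
  set φ : E × ℝ → ℝ := fun c => c.2 + ‖c.1‖ ^ 2 / 2 with hφ
  have hφc : Continuous φ := by fun_prop
  have hbdd : BddBelow (φ '' C) := ⟨0, by rintro - ⟨c, hc, rfl⟩; exact hb c hc⟩
  set m := sInf (φ '' C) with hm
  have hle : ∀ c ∈ C, m ≤ φ c := fun c hc => csInf_le hbdd ⟨c, hc, rfl⟩
  -- Comparing with the midpoint, by the parallelogram law: almost-minimizers have nearby first
  -- components.
  have hmid : ∀ c ∈ C, ∀ d ∈ C, ‖c.1 - d.1‖ ^ 2 ≤ 4 * (φ c - m) + 4 * (φ d - m) := by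
    intro c hc d hd
    have h1 := hle _ (hconv hc hd (by norm_num : (0 : ℝ) ≤ 1 / 2)
      (by norm_num : (0 : ℝ) ≤ 1 / 2) (by norm_num))
    simp only [hφ, Prod.fst_add, Prod.snd_add, Prod.smul_fst, Prod.smul_snd, smul_eq_mul] at h1 ⊢
    rw [← smul_add, norm_smul, mul_pow, norm_add_sq_real] at h1
    rw [norm_sub_sq_real]
    norm_num at h1
    linarith
  have hseq : ∀ n : ℕ, ∃ c ∈ C, φ c < m + 1 / ((n : ℝ) + 1) := fun n => by
    obtain ⟨-, ⟨y, hy, rfl⟩, hlt⟩ :=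
      Real.lt_sInf_add_pos (s := φ '' C) (hne.image _) (Nat.one_div_pos_of_nat (n := n))
    exact ⟨y, hy, hlt⟩
  choose c hcC hc using hseq
  have hφlim : Tendsto (fun n => φ (c n)) atTop (𝓝 m) := by
    refine tendsto_of_tendsto_of_tendsto_of_le_of_le tendsto_const_nhds ?_
      (fun n => hle _ (hcC n)) (fun n => (hc n).le)
    simpa using (tendsto_one_div_add_atTop_nhds_zero_nat (𝕜 := ℝ)).const_add m
  have hcau : CauchySeq fun n => (c n).1 := by
    refine Metric.cauchySeq_iff'.2 fun ε hε => ?_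
    obtain ⟨N, hN⟩ := exists_nat_one_div_lt (show 0 < ε ^ 2 / 8 by positivity)
    refine ⟨N, fun n hn => ?_⟩
    have h1 := hmid _ (hcC n) _ (hcC N)
    have h2 := hc n
    have h3 := hc N
    have h4 : 1 / ((n : ℝ) + 1) ≤ 1 / ((N : ℝ) + 1) := Nat.one_div_le_one_div hn
    rw [dist_eq_norm]
    exact lt_of_pow_lt_pow_left₀ 2 hε.le (by linarith)
  obtain ⟨a, ha⟩ := cauchySeq_tendsto_of_complete hcau
  have hs : Tendsto (fun n => (c n).2) atTop (𝓝 (m - ‖a‖ ^ 2 / 2)) := by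
    have := hφlim.sub ((ha.norm.pow 2).div_const 2)
    refine this.congr fun n => ?_
    simp [hφ]
  have hmem : (a, m - ‖a‖ ^ 2 / 2) ∈ C :=
    hC.mem_of_tendsto (ha.prodMk_nhds hs) (Eventually.of_forall hcC)
  refine ⟨_, hmem, fun d hd => ?_⟩
  have hθ : ∀ θ : ℝ, 0 < θ → θ ≤ 1 →
      m - ‖a‖ ^ 2 / 2 ≤ d.2 + inner ℝ a (d.1 - a) + θ * (‖d.1 - a‖ ^ 2 / 2) := by
    intro θ h0 h1
    have h2 := hle _ (hconv hmem hd (sub_nonneg.2 h1) h0.le (by ring))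
    have h3 : (1 - θ) • a + θ • d.1 = a + θ • (d.1 - a) := by module
    simp only [hφ, Prod.fst_add, Prod.snd_add, Prod.smul_fst, Prod.smul_snd, smul_eq_mul, h3] at h2
    rw [norm_add_sq_real, real_inner_smul_right, norm_smul, Real.norm_of_nonneg h0.le] at h2
    refine le_of_mul_le_mul_left ?_ h0
    nlinarith
  have hl : Tendsto (fun θ : ℝ => d.2 + inner ℝ a (d.1 - a) + θ * (‖d.1 - a‖ ^ 2 / 2)) (𝓝[>] 0)
      (𝓝 (d.2 + inner ℝ a (d.1 - a))) := by
    have : Continuous fun θ : ℝ => d.2 + inner ℝ a (d.1 - a) + θ * (‖d.1 - a‖ ^ 2 / 2) := by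
      fun_prop
    simpa using (this.tendsto 0).mono_left nhdsWithin_le_nhds
  refine ge_of_tendsto hl ?_
  filter_upwards [Ioc_mem_nhdsGT (zero_lt_one (α := ℝ))] with θ h
  exact hθ θ h.1 h.2

section Hilbert

variable {X : Type*} [NormedAddCommGroup X] [InnerProductSpace ℝ X]

/-- Mean value inequality: a Lipschitz function all of whose proximal subgradients have norm at
most `K` is `K`-Lipschitz. -/
theorem le_add_mul_of_proximal_subgradients_bounded [CompleteSpace X] {f : X → ℝ} {L K : ℝ}
    (hL : ∀ x y, f x ≤ f y + L * ‖x - y‖) (hf : Continuous f) (hK : 0 ≤ K)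
    (hprox : ∀ (x ζ : X) (C : ℝ),
      (∀ y, f x + inner ℝ ζ (y - x) - C * ‖y - x‖ ^ 2 ≤ f y) → ‖ζ‖ ≤ K) (a b : X) :
    f b ≤ f a + K * ‖a - b‖ := by
  have main : ∀ M : ℝ, 0 < M →
      f b ≤ f a + K * ‖a - b‖ + M * (3 / 2 * ‖a - b‖ + 5 / 4 * ‖a - b‖ ^ 2) := by
    intro M hM
    -- The slope `K + M` exceeds any subgradient bound by enough to absorb `‖p‖ ≤ M / 2`, so the
    -- perturbed minimizer must be `b`. The quadratic term keeps `g` bounded below.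
    set g : X → ℝ := fun x => f x + (K + M) * ‖x - b‖ + M * ‖x - b‖ ^ 2 with hg
    have hgc : Continuous g := by fun_prop
    have hgb : BddBelow (g '' Set.univ) := by
      refine ⟨f b - L ^ 2 / (4 * M), ?_⟩
      rintro - ⟨x, -, rfl⟩
      have h1 := hL b x
      rw [norm_sub_rev] at h1
      have h2 : L ^ 2 / (4 * M) - L * ‖x - b‖ + M * ‖x - b‖ ^ 2
          = M * (‖x - b‖ - L / (2 * M)) ^ 2 := by
        field_simp
        ring
      have h3 : 0 ≤ M * (‖x - b‖ - L / (2 * M)) ^ 2 := by positivity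
      have h4 : 0 ≤ (K + M) * ‖x - b‖ := by positivity
      simp only [hg]
      linarith
    obtain ⟨c, -, p, hp, hc⟩ := exists_perturbed_minimizer isClosed_univ Set.univ_nonempty hgc hgb
      (ε := M / 4) (by positivity)
    have hcb : c = b := by
      by_contra hne
      set s := ‖c - b‖ with hs
      have hspos : 0 < s := norm_pos_iff.2 (sub_ne_zero.2 hne)
      set κ := (K + M) / s + 2 * M with hκ
      have hκ0 : 0 ≤ κ := by positivity
      have h1 := hprox c (-(κ • (c - b) + p)) ((K + M) / (2 * s) + M + M / 4) (fun y => by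
        have h2 := hc y trivial
        simp only [hg] at h2
        have h3 : ‖y - b‖ ^ 2 = s ^ 2 + 2 * inner ℝ (c - b) (y - c) + ‖y - c‖ ^ 2 := by
          rw [← norm_add_sq_real]
          congr 2
          abel
        -- The norm is majorized by a quadratic that touches it at `c`, which yields a proximal
        -- subgradient there.
        have h4 : (K + M) * ‖y - b‖ ≤ (K + M) * ((‖y - b‖ ^ 2 + s ^ 2) / (2 * s)) := by
          refine mul_le_mul_of_nonneg_left ?_ (by positivity)
          rw [le_div_iff₀ (by positivity)]
          nlinarith [sq_nonneg (‖y - b‖ - s)]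
        have h5 : (K + M) * ((‖y - b‖ ^ 2 + s ^ 2) / (2 * s)) = (K + M) * s
            + (K + M) / s * inner ℝ (c - b) (y - c) + (K + M) / (2 * s) * ‖y - c‖ ^ 2 := by
          rw [h3]
          field_simp
          ring
        rw [inner_neg_left, inner_add_left, real_inner_smul_left, hκ]
        nlinarith)
      have h6 : ‖κ • (c - b)‖ ≤ ‖-(κ • (c - b) + p)‖ + ‖p‖ := by
        rw [norm_neg]
        simpa using norm_sub_le (κ • (c - b) + p) p
      rw [norm_smul, Real.norm_of_nonneg hκ0, ← hs] at h6
      have h7 : κ * s = K + M + 2 * M * s := by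
        rw [hκ]
        field_simp
      have : 0 < 2 * M * s := by positivity
      linarith
    subst hcb
    have h1 := hc a trivial
    simp only [hg, sub_self, norm_zero] at h1
    have h2 := real_inner_le_norm p (a - c)
    have h3 := mul_le_mul_of_nonneg_right hp (norm_nonneg (a - c))
    nlinarith
  have hl : Tendsto (fun M : ℝ =>
      f a + K * ‖a - b‖ + M * (3 / 2 * ‖a - b‖ + 5 / 4 * ‖a - b‖ ^ 2)) (𝓝[>] 0)
      (𝓝 (f a + K * ‖a - b‖)) := by
    have : Continuous fun M : ℝ =>
        f a + K * ‖a - b‖ + M * (3 / 2 * ‖a - b‖ + 5 / 4 * ‖a - b‖ ^ 2) := by fun_prop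
    simpa using (this.tendsto 0).mono_left nhdsWithin_le_nhds
  refine ge_of_tendsto hl ?_
  filter_upwards [self_mem_nhdsWithin] with M hM
  exact main M hM

/-! ### Minty's theorem -/

theorem norm_add_sq_eq_norm_sub_sq_add (x y : X) :
    ‖x + y‖ ^ 2 = ‖x - y‖ ^ 2 + 4 * inner ℝ x y := by
  rw [norm_add_sq_real, norm_sub_sq_real]
  ring

/-- Minty's theorem at `0`, for graphs. -/
theorem exists_mem_add_eq_zero [CompleteSpace X] {G : Set (X × X)} (hne : G.Nonempty)
    (hmono : ∀ p ∈ G, ∀ q ∈ G, 0 ≤ inner ℝ (p.2 - q.2) (p.1 - q.1))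
    (hmax : ∀ p, (∀ q ∈ G, 0 ≤ inner ℝ (p.2 - q.2) (p.1 - q.1)) → p ∈ G) :
    ∃ p ∈ G, p.1 + p.2 = 0 := by
  -- The epigraph of the Fitzpatrick function of `G`, which by maximality dominates the duality
  -- pairing.
  let C : Set (WithLp 2 (X × X) × ℝ) :=
    {c | ∀ q ∈ G, inner ℝ c.1.fst q.2 + inner ℝ q.1 c.1.snd - inner ℝ q.1 q.2 ≤ c.2}
  have hC : IsClosed C := by
    simp only [C, Set.ofPred_forall]
    refine isClosed_biInter fun q _ => isClosed_le ?_ continuous_snd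
    have h1 : Continuous fun c : WithLp 2 (X × X) × ℝ => c.1.fst :=
      continuous_fst.comp ((WithLp.prod_continuous_ofLp 2 X X).comp continuous_fst)
    have h2 : Continuous fun c : WithLp 2 (X × X) × ℝ => c.1.snd :=
      continuous_snd.comp ((WithLp.prod_continuous_ofLp 2 X X).comp continuous_fst)
    fun_prop
  have hconv : Convex ℝ C := by
    intro c hc d hd α β hα hβ hαβ q hq
    have h1 := mul_le_mul_of_nonneg_left (hc q hq) hα
    have h2 := mul_le_mul_of_nonneg_left (hd q hq) hβ
    simp only [Prod.fst_add, Prod.snd_add, Prod.smul_fst, Prod.smul_snd, smul_eq_mul,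
      WithLp.add_fst, WithLp.add_snd, WithLp.smul_fst, WithLp.smul_snd, inner_add_left,
      inner_add_right, real_inner_smul_left, real_inner_smul_right]
    obtain rfl : α = 1 - β := by linarith
    linarith
  have hGC : ∀ q ∈ G, ((WithLp.toLp 2 q, inner ℝ q.1 q.2) : WithLp 2 (X × X) × ℝ) ∈ C := by
    intro q hq p hp
    have := hmono q hq p hp
    simp only [inner_sub_left, inner_sub_right] at this
    change inner ℝ q.1 p.2 + inner ℝ p.1 q.2 - inner ℝ p.1 p.2 ≤ inner ℝ q.1 q.2
    rw [real_inner_comm p.2, real_inner_comm q.2, real_inner_comm p.2 p.1,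
      real_inner_comm q.2 q.1]
    linarith
  have hle : ∀ c ∈ C, inner ℝ c.1.fst c.1.snd ≤ c.2 := by
    intro c hc
    by_contra! hlt
    refine hlt.not_ge ?_
    have := hc (c.1.fst, c.1.snd) (hmax _ fun q hq => by
      have := hc q hq
      simp only [inner_sub_left, inner_sub_right]
      rw [real_inner_comm c.1.fst c.1.snd, real_inner_comm q.1 c.1.snd,
        real_inner_comm c.1.fst q.2, real_inner_comm q.1 q.2]
      linarith)
    simpa using this
  obtain ⟨c, hcC, hc⟩ := exists_minimizer_of_convex hC hconv
    (hne.elim fun q hq => ⟨_, hGC q hq⟩) (fun c hc => by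
      have h1 := hle c hc
      have h2 := norm_add_sq_real c.1.fst c.1.snd
      have h3 := sq_nonneg ‖c.1.fst + c.1.snd‖
      rw [WithLp.prod_norm_sq_eq_of_L2]
      linarith)
  set x := c.1.fst with hx
  set y := c.1.snd with hy
  have hcle := hle c hcC
  -- Optimality of `(x, y)` tested on `G`: the point `(-y, -x)` is monotonically related to `G`,
  -- hence lies in it, and `q = (-y, -x)` then gives `x + y = 0`.
  have key : ∀ q ∈ G, ‖x + y‖ ^ 2 ≤ inner ℝ (-x - q.2) (-y - q.1) := by
    intro q hq
    have h1 := hc _ (hGC q hq)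
    rw [WithLp.prod_inner_apply] at h1
    change c.2 ≤ inner ℝ q.1 q.2 + (inner ℝ x (q.1 - x) + inner ℝ y (q.2 - y)) at h1
    rw [norm_add_sq_real, ← real_inner_self_eq_norm_sq, ← real_inner_self_eq_norm_sq]
    simp only [inner_sub_left, inner_sub_right, inner_neg_left, inner_neg_right] at h1 ⊢
    rw [real_inner_comm y q.2, real_inner_comm q.2 q.1] at *
    linarith
  have hmem : (-y, -x) ∈ G := hmax _ fun q hq => (sq_nonneg _).trans (key q hq)
  refine ⟨_, hmem, ?_⟩
  have h1 := key _ hmem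
  simp only [sub_self, inner_zero_left] at h1
  have h2 : ‖x + y‖ = 0 := by nlinarith [norm_nonneg (x + y)]
  rw [norm_eq_zero] at h2
  simp only
  rw [← neg_add, add_comm, h2, neg_zero]

/-- Minty's theorem, for graphs. -/
theorem exists_mem_add_eq [CompleteSpace X] {G : Set (X × X)} (hne : G.Nonempty)
    (hmono : ∀ p ∈ G, ∀ q ∈ G, 0 ≤ inner ℝ (p.2 - q.2) (p.1 - q.1))
    (hmax : ∀ p, (∀ q ∈ G, 0 ≤ inner ℝ (p.2 - q.2) (p.1 - q.1)) → p ∈ G) (ξ : X) :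
    ∃ p ∈ G, p.1 + p.2 = ξ := by
  obtain ⟨p, hp, h0⟩ := exists_mem_add_eq_zero (G := {p | (p.1, p.2 + ξ) ∈ G})
    (hne.elim fun q hq => ⟨(q.1, q.2 - ξ), by simpa using hq⟩)
    (fun p hp q hq => by simpa using hmono _ hp _ hq)
    (fun p hp => hmax _ fun q hq => by
      have := hp (q.1, q.2 - ξ) (by simpa using hq)
      simpa [sub_sub_eq_add_sub] using this)
  exact ⟨_, hp, by simp only [← add_assoc, h0, zero_add]⟩

/-! ### Coderivatives of maximal monotone mappings -/

variable {T : X → Set X}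

theorem IsMaximalMonotone.mem_gph (hT : IsMaximalMonotone T) {x y : X}
    (h : ∀ a b, (a, b) ∈ gph T → 0 ≤ inner ℝ (y - b) (x - a)) : (x, y) ∈ gph T := by
  let S : X → Set X := fun u => {v | (u, v) ∈ gph T ∨ (u, v) = (x, y)}
  have hS : IsMonotone S := by
    rintro u₁ v₁ u₂ v₂ (h1 | h1) (h2 | h2)
    · exact hT.1 _ _ _ _ h1 h2
    · obtain ⟨rfl, rfl⟩ := Prod.mk.inj h2
      have := h _ _ h1
      rwa [← neg_sub, ← neg_sub u₁, inner_neg_neg] at this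
    · obtain ⟨rfl, rfl⟩ := Prod.mk.inj h1
      exact h _ _ h2
    · obtain ⟨rfl, rfl⟩ := Prod.mk.inj h1
      obtain ⟨rfl, rfl⟩ := Prod.mk.inj h2
      simp
  rw [hT.2 S hS fun p hp => Or.inl hp]
  exact Or.inr rfl

theorem IsMaximalMonotone.exists_add_eq [CompleteSpace X] (hT : IsMaximalMonotone T)
    (hne : (gph T).Nonempty) (ξ : X) : ∃ u v, (u, v) ∈ gph T ∧ u + v = ξ := by
  obtain ⟨p, hp, h⟩ := exists_mem_add_eq hne (fun p hp q hq => hT.1 _ _ _ _ hp hq)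
    (fun p hp => hT.mem_gph fun a b hab => hp (a, b) hab) ξ
  exact ⟨_, _, hp, h⟩

theorem IsMaximalMonotone.inner_nonneg_of_mem_regularCoderivative [CompleteSpace X]
    (hT : IsMaximalMonotone T) {u v w z : X} (huv : (u, v) ∈ gph T)
    (hz : z ∈ regularCoderivative T u v w) : 0 ≤ inner ℝ z w := by
  have hN := (mem_regularNormalCone_iff (Ω := {p : WithLp 2 (X × X) | WithLp.ofLp p ∈ gph T})
    (a := WithLp.toLp 2 (u, v)) huv).1 hz
  rcases eq_or_ne z w with rfl | hne
  · exact real_inner_self_nonneg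
  have hpos : 0 < ‖z - w‖ := norm_pos_iff.2 (sub_ne_zero.2 hne)
  have hle : ‖z - w‖ ≤ ‖z + w‖ := by
    refine le_of_forall_pos_le_add fun ε hε => ?_
    have h1 := hN (ε / 2) (by positivity)
    rw [eventually_nhdsWithin_iff, Metric.eventually_nhds_iff] at h1
    obtain ⟨δ, hδ, h1⟩ := h1
    -- This makes `‖d‖ = δ / 2`, and monotonicity keeps `(a, b)` within `‖d‖` of `(u, v)`.
    set t := δ / (2 * ‖z - w‖) with ht
    have htpos : 0 < t := by positivity
    obtain ⟨a, b, hab, hsum⟩ := hT.exists_add_eq ⟨_, huv⟩ (u + v + t • (z - w))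
    set d := t • (z - w) with hd
    have hdn : ‖d‖ = t * ‖z - w‖ := by rw [hd, norm_smul, Real.norm_of_nonneg htpos.le]
    have hd' : (a - u) + (b - v) = d := by
      rw [sub_add_sub_comm, hsum, add_sub_cancel_left]
    set q := (a - u) - (b - v) with hq
    have h2 := hT.1 _ _ _ _ hab huv
    have h3 := norm_add_sq_eq_norm_sub_sq_add (a - u) (b - v)
    rw [hd', ← hq, real_inner_comm] at h3
    have hqd : ‖q‖ ≤ ‖d‖ := le_of_sq_le_sq (by linarith) (norm_nonneg _)
    have h4 := parallelogram_law_with_norm ℝ (a - u) (b - v)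
    rw [hd', ← hq] at h4
    have h5 : ‖WithLp.toLp 2 (a, b) - WithLp.toLp 2 (u, v)‖ ≤ ‖d‖ := by
      refine le_of_sq_le_sq ?_ (norm_nonneg _)
      rw [WithLp.prod_norm_sq_eq_of_L2]
      change ‖a - u‖ ^ 2 + ‖b - v‖ ^ 2 ≤ _
      linarith
    have h6 := h1 (y := WithLp.toLp 2 (a, b)) (by
      rw [dist_eq_norm]
      refine h5.trans_lt ?_
      rw [hdn, ht]
      field_simp
      linarith) hab
    rw [WithLp.prod_inner_apply] at h6
    change inner ℝ z (a - u) + inner ℝ (-w) (b - v) ≤ _ at h6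
    have h7 : 2 * (inner ℝ z (a - u) + inner ℝ (-w) (b - v))
        = inner ℝ (z - w) d + inner ℝ (z + w) q := by
      rw [← hd', hq]
      simp only [inner_sub_left, inner_sub_right, inner_add_left, inner_add_right, inner_neg_left]
      ring
    have h8 : inner ℝ (z - w) d = t * ‖z - w‖ * ‖z - w‖ := by
      rw [hd, real_inner_smul_right, real_inner_self_eq_norm_sq]
      ring
    have h9 := (abs_le.1 (abs_real_inner_le_norm (z + w) q)).1
    have h10 := mul_le_mul_of_nonneg_left hqd (norm_nonneg (z + w))
    have h11 := mul_le_mul_of_nonneg_left h5 (half_pos hε).le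
    rw [hdn] at h10 h11
    refine le_of_mul_le_mul_left ?_ (mul_pos htpos hpos)
    linarith
  have h1 := norm_add_sq_eq_norm_sub_sq_add z w
  have h2 := pow_le_pow_left₀ hpos.le hle 2
  linarith

/-- Proximal normals to the graph are regular normals. -/
theorem mem_regularCoderivative_of_proximal {u v w z : X} (huv : (u, v) ∈ gph T) {C : ℝ}
    (h : ∀ a b, (a, b) ∈ gph T →
      inner ℝ z (a - u) - inner ℝ w (b - v) ≤ C * (‖a - u‖ ^ 2 + ‖b - v‖ ^ 2)) :
    z ∈ regularCoderivative T u v w := by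
  refine (mem_regularNormalCone_iff (Ω := {p : WithLp 2 (X × X) | WithLp.ofLp p ∈ gph T})
    (a := WithLp.toLp 2 (u, v)) huv).2 fun ε hε => ?_
  rw [eventually_nhdsWithin_iff]
  have hcont : Continuous fun p : WithLp 2 (X × X) => C * ‖p - WithLp.toLp 2 (u, v)‖ := by
    fun_prop
  have h0 := hcont.tendsto (WithLp.toLp 2 (u, v))
  simp only [sub_self, norm_zero, mul_zero] at h0
  filter_upwards [h0.eventually_lt_const hε] with p hp hpT
  have h1 := h p.fst p.snd hpT
  have h2 := WithLp.prod_norm_sq_eq_of_L2 (p - WithLp.toLp 2 (u, v))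
  change _ = ‖p.fst - u‖ ^ 2 + ‖p.snd - v‖ ^ 2 at h2
  rw [← h2] at h1
  rw [WithLp.prod_inner_apply]
  change inner ℝ z (p.fst - u) + inner ℝ (-w) (p.snd - v) ≤ _
  rw [inner_neg_left]
  have h3 := mul_le_mul_of_nonneg_right hp.le (norm_nonneg (p - WithLp.toLp 2 (u, v)))
  linarith

end Hilbert

/-! ### From the coderivative condition to maximal monotonicity -/

section Converse

variable {X : Type*} [NormedAddCommGroup X] [InnerProductSpace ℝ X] {T : X → Set X}

/-- Under positive semidefiniteness of the regular coderivative, the proximal subgradients of the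
Cayley transform `u + l • v ↦ u - l • v` have norm at most one. -/
theorem norm_le_of_proximal_cayley
    (hpos : ∀ u v : X, (u, v) ∈ gph T → ∀ w z : X, z ∈ regularCoderivative T u v w →
      0 ≤ inner ℝ z w) {l : ℝ} (hl : 0 < l) {u v : X} (huv : (u, v) ∈ gph T) {ζ h : X} {C : ℝ}
    (H : ∀ a b, (a, b) ∈ gph T →
      inner ℝ ζ ((a + l • b) - (u + l • v)) - inner ℝ h ((a - l • b) - (u - l • v)) ≤
        C * ‖(a + l • b) - (u + l • v)‖ ^ 2) :
    ‖ζ‖ ≤ ‖h‖ := by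
  -- The proximal normal `(ζ, -h)` is pulled back by the linear change of variables; positivity then
  -- reads `0 ≤ l * (‖h‖ ^ 2 - ‖ζ‖ ^ 2)`.
  have hmem : ζ - h ∈ regularCoderivative T u v (-(l • (ζ + h))) := by
    refine mem_regularCoderivative_of_proximal huv (C := |C| * (2 + 2 * l ^ 2)) fun a b hab => ?_
    have h1 := H a b hab
    have e1 : (a + l • b) - (u + l • v) = (a - u) + l • (b - v) := by module
    have e2 : (a - l • b) - (u - l • v) = (a - u) - l • (b - v) := by module
    rw [e1, e2] at h1
    have h2 := parallelogram_law_with_norm ℝ (a - u) (l • (b - v))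
    rw [norm_smul, Real.norm_of_nonneg hl.le] at h2
    have h3 : ‖(a - u) + l • (b - v)‖ ^ 2 ≤ (2 + 2 * l ^ 2) * (‖a - u‖ ^ 2 + ‖b - v‖ ^ 2) := by
      have h4 : 0 ≤ l ^ 2 * ‖a - u‖ ^ 2 := by positivity
      have h5 := mul_self_nonneg ‖(a - u) - l • (b - v)‖
      have h6 := sq_nonneg ‖b - v‖
      linarith
    have h4 : C * ‖(a - u) + l • (b - v)‖ ^ 2
        ≤ |C| * ((2 + 2 * l ^ 2) * (‖a - u‖ ^ 2 + ‖b - v‖ ^ 2)) :=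
      mul_le_mul (le_abs_self C) h3 (sq_nonneg _) (abs_nonneg C)
    rw [inner_sub_left, inner_neg_left, real_inner_smul_left, inner_add_left]
    rw [inner_add_right, inner_sub_right h, real_inner_smul_right, real_inner_smul_right] at h1
    linarith
  have h1 := hpos u v huv _ _ hmem
  rw [inner_neg_right, real_inner_smul_right, inner_sub_left, inner_add_right, inner_add_right,
    real_inner_self_eq_norm_sq, real_inner_self_eq_norm_sq, real_inner_comm ζ h] at h1
  have h2 : 0 ≤ l * (‖h‖ ^ 2 - ‖ζ‖ ^ 2) := by linarith
  have h3 := nonneg_of_mul_nonneg_right h2 hl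
  exact le_of_sq_le_sq (by linarith) (norm_nonneg _)

/-- Expansiveness of `I + l T` for `l = 1 / (2 r)` when `T + r I` is monotone. -/
theorem norm_sub_le_of_hypomonotone {r : ℝ} (hr : 0 < r) (hT : IsMonotone (addSMulId T r))
    {u v a b : X} (huv : (u, v) ∈ gph T) (hab : (a, b) ∈ gph T) :
    ‖a - u‖ ≤ 2 * ‖(a + (1 / (2 * r)) • b) - (u + (1 / (2 * r)) • v)‖ := by
  have h1 := hT a (b + r • a) u (v + r • u) ⟨b, hab, rfl⟩ ⟨v, huv, rfl⟩
  have e1 : (b + r • a) - (v + r • u) = (b - v) + r • (a - u) := by module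
  have e2 : (a + (1 / (2 * r)) • b) - (u + (1 / (2 * r)) • v)
      = (a - u) + (1 / (2 * r)) • (b - v) := by module
  rw [e1, inner_add_left, real_inner_smul_left, real_inner_self_eq_norm_sq] at h1
  rw [e2]
  have h2 := real_inner_le_norm ((a - u) + (1 / (2 * r)) • (b - v)) (a - u)
  rw [inner_add_left, real_inner_smul_left, real_inner_self_eq_norm_sq] at h2
  have h3 : 1 / (2 * r) * (-(r * ‖a - u‖ ^ 2)) ≤ 1 / (2 * r) * inner ℝ (b - v) (a - u) :=
    mul_le_mul_of_nonneg_left (by linarith) (by positivity)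
  have h4 : 1 / (2 * r) * (-(r * ‖a - u‖ ^ 2)) = -(‖a - u‖ ^ 2 / 2) := by
    field_simp
  rcases (norm_nonneg (a - u)).eq_or_lt with h0 | h0
  · rw [← h0]
    positivity
  · refine le_of_mul_le_mul_right ?_ h0
    linarith

/-- Expansiveness and completeness make the range of `I + l T` closed. It is dense because its
proximal normals vanish (the Cayley bound with `h = 0`), so an approximate projection of `y` is
close to `y`. -/
theorem exists_add_smul_eq_of_coderivative_nonneg [CompleteSpace X] (hne : (gph T).Nonempty)
    (hclosed : IsClosed (gph T))
    (hpos : ∀ u v : X, (u, v) ∈ gph T → ∀ w z : X, z ∈ regularCoderivative T u v w →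
      0 ≤ inner ℝ z w) {l κ : ℝ} (hl : 0 < l) (hκ : 0 ≤ κ)
    (hexp : ∀ u v a b, (u, v) ∈ gph T → (a, b) ∈ gph T →
      ‖a - u‖ ≤ κ * ‖(a + l • b) - (u + l • v)‖) (y : X) :
    ∃ u v, (u, v) ∈ gph T ∧ u + l • v = y := by
  set φ : gph T → X := fun p => p.1.1 + l • p.1.2 with hφ
  have hcl : IsClosed (Set.range φ) := by
    have : CompleteSpace (gph T) := hclosed.completeSpace_coe
    have hanti : AntilipschitzWith (Real.toNNReal (κ + (1 + κ) / l)) φ := by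
      refine AntilipschitzWith.of_le_mul_dist fun p q => ?_
      rw [Real.coe_toNNReal _ (by positivity), Subtype.dist_eq, Prod.dist_eq, dist_eq_norm,
        dist_eq_norm, dist_eq_norm]
      have h1 := hexp _ _ _ _ q.2 p.2
      change ‖p.1.1 - q.1.1‖ ≤ κ * ‖φ p - φ q‖ at h1
      have h2 : l • (p.1.2 - q.1.2) = (φ p - φ q) - (p.1.1 - q.1.1) := by
        simp only [hφ]
        module
      have h3 := norm_sub_le (φ p - φ q) (p.1.1 - q.1.1)
      rw [← h2, norm_smul, Real.norm_of_nonneg hl.le] at h3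
      have h4 : ‖p.1.2 - q.1.2‖ ≤ (1 + κ) / l * ‖φ p - φ q‖ := by
        rw [div_mul_eq_mul_div, le_div_iff₀ hl]
        linarith
      have h5 : 0 ≤ (1 + κ) / l * ‖φ p - φ q‖ := by positivity
      have h6 : 0 ≤ κ * ‖φ p - φ q‖ := by positivity
      rw [add_mul]
      exact max_le (by linarith) (by linarith)
    have huc : UniformContinuous φ := by
      refine UniformContinuous.add (uniformContinuous_fst.comp uniformContinuous_subtype_val)
        (UniformContinuous.const_smul (uniformContinuous_snd.comp uniformContinuous_subtype_val) l)
    exact hanti.isClosed_range huc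
  have hdense : y ∈ closure (Set.range φ) := by
    refine Metric.mem_closure_iff.2 fun ε hε => ?_
    have : Nonempty (gph T) := hne.to_subtype
    obtain ⟨-, ⟨⟨⟨u, v⟩, huv⟩, rfl⟩, p, hp, hmin⟩ := exists_perturbed_minimizer hcl
      (Set.range_nonempty φ) (f := fun x => ‖x - y‖ ^ 2) (by fun_prop)
      ⟨0, by rintro - ⟨x, -, rfl⟩; positivity⟩ (ε := ε / 2) (by positivity)
    refine ⟨_, ⟨⟨(u, v), huv⟩, rfl⟩, ?_⟩
    set x := φ ⟨(u, v), huv⟩ with hx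
    have h0 := norm_le_of_proximal_cayley hpos hl huv (ζ := (2 : ℝ) • (y - x) - p) (h := 0)
      (C := 1 + ε / 2) (fun a b hab => by
        have h1 := hmin _ ⟨⟨(a, b), hab⟩, rfl⟩
        change ‖x - y‖ ^ 2 ≤ ‖(a + l • b) - y‖ ^ 2 + inner ℝ p ((a + l • b) - x)
          + ε / 2 * ‖(a + l • b) - x‖ ^ 2 at h1
        change inner ℝ _ ((a + l • b) - x) - _ ≤ _ * ‖(a + l • b) - x‖ ^ 2
        have h2 : (a + l • b) - y = ((a + l • b) - x) - (y - x) := by abel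
        rw [h2, norm_sub_sq_real (a + l • b - x), norm_sub_rev x y, real_inner_comm (y - x)] at h1
        rw [inner_zero_left, inner_sub_left, real_inner_smul_left]
        linarith)
    rw [norm_zero, norm_le_zero_iff, sub_eq_zero] at h0
    have h1 : 2 * ‖y - x‖ = ‖p‖ := by
      rw [← h0, norm_smul, Real.norm_two]
    rw [dist_eq_norm]
    linarith
  obtain ⟨⟨⟨u, v⟩, huv⟩, h⟩ := hcl.closure_eq ▸ hdense
  exact ⟨u, v, huv, h⟩

/-- The Cayley transform `Q` is a globally defined Lipschitz map here. Scalarizing by `h = Q x - Q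
y` and applying the mean value inequality with bound `‖h‖` gives `‖h‖ ^ 2 ≤ ‖h‖ * ‖x - y‖`. -/
theorem isMonotone_of_coderivative_nonneg [CompleteSpace X]
    (hpos : ∀ u v : X, (u, v) ∈ gph T → ∀ w z : X, z ∈ regularCoderivative T u v w →
      0 ≤ inner ℝ z w) {l κ : ℝ} (hl : 0 < l) (hκ : 0 ≤ κ)
    (hexp : ∀ u v a b, (u, v) ∈ gph T → (a, b) ∈ gph T →
      ‖a - u‖ ≤ κ * ‖(a + l • b) - (u + l • v)‖)
    (hsurj : ∀ y, ∃ u v, (u, v) ∈ gph T ∧ u + l • v = y) : IsMonotone T := by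
  choose U V hUV hsum using hsurj
  have huniq : ∀ u v, (u, v) ∈ gph T → U (u + l • v) = u ∧ V (u + l • v) = v := by
    intro u v huv
    have h1 := hexp u v _ _ huv (hUV (u + l • v))
    rw [hsum, sub_self, norm_zero, mul_zero, norm_le_zero_iff, sub_eq_zero] at h1
    refine ⟨h1, ?_⟩
    have h2 := hsum (u + l • v)
    rw [h1] at h2
    exact smul_right_injective X hl.ne' (add_left_cancel h2)
  set Q : X → X := fun x => U x - l • V x with hQ
  have hQU : ∀ x, Q x = (2 : ℝ) • U x - x := fun x => by
    have h1 : Q x = (2 : ℝ) • U x - (U x + l • V x) := by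
      simp only [hQ]
      module
    rwa [hsum] at h1
  have hQlip : ∀ x y, ‖Q x - Q y‖ ≤ (2 * κ + 1) * ‖x - y‖ := by
    intro x y
    have h1 := hexp _ _ _ _ (hUV y) (hUV x)
    rw [hsum, hsum] at h1
    have h2 : Q x - Q y = (2 : ℝ) • (U x - U y) - (x - y) := by
      rw [hQU, hQU]
      module
    have h3 := norm_sub_le ((2 : ℝ) • (U x - U y)) (x - y)
    rw [← h2, norm_smul, Real.norm_two] at h3
    linarith
  have hQc : Continuous Q := (LipschitzWith.of_dist_le_mul (K := Real.toNNReal (2 * κ + 1))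
    fun x y => by
      rw [Real.coe_toNNReal _ (by positivity), dist_eq_norm, dist_eq_norm]
      exact hQlip x y).continuous
  have hnonexp : ∀ x y, ‖Q x - Q y‖ ≤ ‖x - y‖ := by
    intro x y
    set h := Q x - Q y with hh
    have h1 := le_add_mul_of_proximal_subgradients_bounded (f := fun x => inner ℝ h (Q x))
      (L := ‖h‖ * (2 * κ + 1)) (K := ‖h‖)
      (fun a b => by
        have h2 := real_inner_le_norm h (Q a - Q b)
        rw [inner_sub_right] at h2
        have h3 := mul_le_mul_of_nonneg_left (hQlip a b) (norm_nonneg h)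
        linarith) (by fun_prop) (norm_nonneg _)
      (fun a ζ C hC => norm_le_of_proximal_cayley hpos hl (hUV a) (C := C) fun u v huv => by
        have h2 := hC (u + l • v)
        have h3 : Q (u + l • v) = u - l • v := by
          rw [hQ]
          simp only
          rw [(huniq u v huv).1, (huniq u v huv).2]
        rw [h3] at h2
        change inner ℝ h (U a - l • V a) + _ - _ ≤ _ at h2
        rw [hsum, inner_sub_right h]
        linarith) y x
    have h2 : ‖h‖ * ‖h‖ = inner ℝ h (Q x) - inner ℝ h (Q y) := by
      rw [← inner_sub_right, ← hh, real_inner_self_eq_norm_mul_norm]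
    rw [norm_sub_rev y x] at h1
    rcases (norm_nonneg h).eq_or_lt with h0 | h0
    · rw [← h0]
      positivity
    · exact le_of_mul_le_mul_left (by linarith) h0
  intro u₁ v₁ u₂ v₂ h₁ h₂
  have h := hnonexp (u₁ + l • v₁) (u₂ + l • v₂)
  simp only [hQ, (huniq _ _ h₁).1, (huniq _ _ h₁).2, (huniq _ _ h₂).1, (huniq _ _ h₂).2] at h
  have e1 : (u₁ - l • v₁) - (u₂ - l • v₂) = (u₁ - u₂) - l • (v₁ - v₂) := by module
  have e2 : (u₁ + l • v₁) - (u₂ + l • v₂) = (u₁ - u₂) + l • (v₁ - v₂) := by module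
  rw [e1, e2] at h
  have h3 := norm_add_sq_eq_norm_sub_sq_add (u₁ - u₂) (l • (v₁ - v₂))
  have h4 := pow_le_pow_left₀ (norm_nonneg _) h 2
  rw [real_inner_smul_right] at h3
  rw [real_inner_comm]
  exact nonneg_of_mul_nonneg_right (by linarith : 0 ≤ l * inner ℝ (u₁ - u₂) (v₁ - v₂)) hl

/-- A monotone mapping `T` with `I + l T` surjective is maximal monotone. -/
theorem IsMonotone.isMaximalMonotone (hT : IsMonotone T) {l : ℝ} (hl : 0 < l)
    (hsurj : ∀ y, ∃ u v, (u, v) ∈ gph T ∧ u + l • v = y) : IsMaximalMonotone T := by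
  refine ⟨hT, fun S hS hTS => hTS.antisymm ?_⟩
  rintro ⟨x, y⟩ hxy
  -- A graph point of `T` with the same image under `I + l S`; monotonicity of `S` forces it to
  -- equal `(x, y)`.
  obtain ⟨u, v, huv, h⟩ := hsurj (x + l • y)
  have h1 := hS _ _ _ _ hxy (hTS huv)
  have h2 : x - u = -(l • (y - v)) := by
    rw [smul_sub, neg_sub, sub_eq_sub_iff_add_eq_add, ← h, add_comm]
  rw [h2, inner_neg_right, real_inner_smul_right, real_inner_self_eq_norm_sq] at h1
  have h3 : ‖y - v‖ ^ 2 ≤ 0 := by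
    by_contra! hlt
    have := mul_pos hl hlt
    linarith
  have h4 : y - v = 0 := norm_eq_zero.1 (pow_eq_zero_iff two_ne_zero |>.1
    (h3.antisymm (sq_nonneg _)))
  rw [h4, smul_zero, neg_zero, sub_eq_zero] at h2
  rw [sub_eq_zero] at h4
  rwa [h2, h4]

theorem IsMonotone.isHypomonotone (hT : IsMonotone T) : IsHypomonotone T := by
  refine ⟨1, one_pos, ?_⟩
  intro u₁ y₁ u₂ y₂ hy₁ hy₂
  obtain ⟨v₁, h₁, rfl⟩ : ∃ v, v ∈ T u₁ ∧ v + (1 : ℝ) • u₁ = y₁ := hy₁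
  obtain ⟨v₂, h₂, rfl⟩ : ∃ v, v ∈ T u₂ ∧ v + (1 : ℝ) • u₂ = y₂ := hy₂
  have h := hT u₁ v₁ u₂ v₂ h₁ h₂
  have e : (v₁ + (1 : ℝ) • u₁) - (v₂ + (1 : ℝ) • u₂) = (v₁ - v₂) + (u₁ - u₂) := by module
  rw [e, inner_add_left]
  exact add_nonneg h real_inner_self_nonneg

end Converse

end VarAnalysis

open VarAnalysis in
theorem theorem3p2 {X : Type*} [NormedAddCommGroup X] [InnerProductSpace ℝ X] [CompleteSpace X]
    (T : X → Set X) (hproper : VarAnalysis.IsProper T) (hclosed : IsClosed (VarAnalysis.gph T)) :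
    VarAnalysis.IsMaximalMonotone T ↔
      (VarAnalysis.IsHypomonotone T ∧
        ∀ u v : X, (u, v) ∈ VarAnalysis.gph T →
          ∀ w z : X, z ∈ VarAnalysis.regularCoderivative T u v w → 0 ≤ inner ℝ z w) := by
  constructor
  · intro hT
    exact ⟨hT.1.isHypomonotone, fun u v huv w z hz =>
      hT.inner_nonneg_of_mem_regularCoderivative huv hz⟩
  · rintro ⟨⟨r, hr, hmono⟩, hpos⟩
    obtain ⟨u, v, huv⟩ := hproper
    have hl : 0 < 1 / (2 * r) := by positivity
    have hexp := fun (u v a b : X) (h₁ : (u, v) ∈ gph T) (h₂ : (a, b) ∈ gph T) =>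
      norm_sub_le_of_hypomonotone hr hmono h₁ h₂
    have hsurj := exists_add_smul_eq_of_coderivative_nonneg ⟨(u, v), huv⟩ hclosed hpos hl
      zero_le_two hexp
    exact (isMonotone_of_coderivative_nonneg hpos hl zero_le_two hexp hsurj).isMaximalMonotone
      hl hsurj
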